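/- Let $\mathscr{A}=\bigoplus_{n\in\mathbb{Z}}\mathscr{A}_{(n)}$ be a $\mathbb{Z}$-graded unital complex $*$-algebra with $(\mathscr{A}_{(n)})^*\subseteq\mathscr{A}_{(-n)}$, and for $w\in S^1$ let $\sigma_w$ be the automorphism of $\mathscr{A}$ with $\sigma_w(x)=w^{-n}x$ for $x\in\mathscr{A}_{(n)}$. Let $\|\cdot\|$ be a $C^*$-norm on $\mathscr{A}$ with $\|\sigma_w(x)\|\le\|x\|$ for all $w\in S^1$, $x\in\mathscr{A}$, let $A$ be the completion of $\mathscr{A}$, and denote by $\sigma_w$ also the extension by continuity to a strongly continuous circle action on $A$. For $n\in\mathbb{Z}$ let $A_{(n)}=\{x\in A:\sigma_w(x)=w^{-n}x\text{ for all }w\in S^1\}$, a right Hilbert $C^*$-module over the $C^*$-algebra $A_{(0)}$ with right action by multiplication and $\langle x,y\rangle=x^*y$; it carries the left action $\phi(a)(x)=ax$ of $A_{(0)}$ by adjointable operators. Let $d\ge 1$ be an integer, and let $A^{1/d}$ be the completion of the $*$-subalgebra $\mathscr{A}^{1/d}=\bigoplus_{n\in\mathbb{Z}}\mathscr{A}_{(nd)}$,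 that is its closure in $A$, with the circle action and the spectral subspaces $(A^{1/d})_{(n)}$ obtained in the same way from the grading $(\mathscr{A}^{1/d})_{(n)}=\mathscr{A}_{(nd)}$. Suppose that the circle action on $A$ is semi-saturated, that is, $A$ is generated as a $C^*$-algebra by $A_{(0)}\cup A_{(1)}$. Then $(A^{1/d})_{(0)}=A_{(0)}$ as subalgebras of $A$, and there are unitary isomorphisms of Hilbert $C^*$-modules over this algebra \[ (A_{(1)})^{\widehat\otimes_\phi d}\cong(A^{1/d})_{(1)}\qquad\text{and}\qquad (A_{(-1)})^{\widehat\otimes_\phi d}\cong(A^{1/d})_{(-1)}, \] both induced by the product $x_1\otimes\cdots\otimes x_d\mapsto x_1\cdots x_d$. Here $\widehat\otimes_\phi d$ denotes the $d$-fold interior tensor power: the interior tensor product $E\widehat\otimes_\phi F$ is the completion of the algebraic tensor product $E\otimes F$ modulo vectors of length zero, for the inner product $\langle x\otimes y,x'\otimes y'\rangle=\langle y,\phi(\langle x,x'\rangle)y'\rangle$. -/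

import Mathlib

universe u

namespace Pimsner

open scoped TensorProduct
open UniformSpace

/-- A right Hilbert `C⋆`-module over a (unital) `C⋆`-algebra `B`: a complete normed space with a
right action of `B` (`right (op b) x` is `x · b`) and a `B`-valued inner product which is
conjugate-linear in the first and linear in the second variable, positive (`⟪x, x⟫` is of the form
`b⋆ b`), and induces the norm (hence is definite). Mathlib's `CStarModule` uses the opposite
convention, with an inner product that is linear for a left action. -/
structure HilbertModule (B : Type u) [CStarAlgebra B] where
  carrier : Type u
  [instNormedAddCommGroup : NormedAddCommGroup carrier]
  [instNormedSpace : NormedSpace ℂ carrier]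
  [instCompleteSpace : CompleteSpace carrier]
  right : Bᵐᵒᵖ →ₐ[ℂ] Module.End ℂ carrier
  inner : carrier →ₗ⋆[ℂ] carrier →ₗ[ℂ] B
  inner_right : ∀ x y b, inner x (right (MulOpposite.op b) y) = inner x y * b
  star_inner : ∀ x y, star (inner x y) = inner y x
  inner_self : ∀ x, ∃ b : B, inner x x = star b * b
  norm_sq : ∀ x, ‖x‖ ^ 2 = ‖inner x x‖

attribute [instance] HilbertModule.instNormedAddCommGroup HilbertModule.instNormedSpace
  HilbertModule.instCompleteSpace

instance (B : Type u) [CStarAlgebra B] : CoeSort (HilbertModule B) (Type u) :=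
  ⟨HilbertModule.carrier⟩

/-- A `C⋆`-correspondence over `B`: a right Hilbert `C⋆`-module with a `*`-homomorphism `left`
from `B` to the adjointable operators. -/
structure Correspondence (B : Type u) [CStarAlgebra B] extends HilbertModule B where
  left : B →ₙₐ[ℂ] Module.End ℂ carrier
  inner_left : ∀ b x y, inner (left b x) y = inner x (left (star b) y)

instance (B : Type u) [CStarAlgebra B] : CoeSort (Correspondence B) (Type u) :=
  ⟨fun E => E.carrier⟩

/-- The data of a correspondence on a vector space `V`, whose inner product is only positive
semidefinite and which need not be complete. -/
structure PreCorrespondence (B : Type u) [CStarAlgebra B] (V : Type u) [AddCommGroup V]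
    [Module ℂ V] where
  right : Bᵐᵒᵖ →ₐ[ℂ] Module.End ℂ V
  inner : V →ₗ⋆[ℂ] V →ₗ[ℂ] B
  inner_right : ∀ x y b, inner x (right (MulOpposite.op b) y) = inner x y * b
  star_inner : ∀ x y, star (inner x y) = inner y x
  inner_self : ∀ x, ∃ b : B, inner x x = star b * b
  left : B →ₙₐ[ℂ] Module.End ℂ V
  inner_left : ∀ b x y, inner (left b x) y = inner x (left (star b) y)

namespace PreCorrespondence

variable {B : Type u} [CStarAlgebra B] {V : Type u} [AddCommGroup V] [Module ℂ V]
  (P : PreCorrespondence B V)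

theorem inner_right_left (x y : V) (b : B) :
    P.inner (P.right (MulOpposite.op b) x) y = star b * P.inner x y := by
  rw [← P.star_inner, P.inner_right, star_mul, P.star_inner]

theorem norm_inner_sq_le (x y : V) : ‖P.inner x y‖ ^ 2 ≤ ‖P.inner x x‖ * ‖P.inner y y‖ := by
  let _ := CStarAlgebra.spectralOrder B
  have _ := CStarAlgebra.spectralOrderedRing B
  set a := P.inner x y with ha
  have hpos : ∀ z, 0 ≤ P.inner z z := fun z =>
    CStarAlgebra.nonneg_iff_eq_star_mul_self.2 (P.inner_self z)
  have key : ∀ t : ℝ, (2 * t - t ^ 2 * ‖P.inner x x‖) • (star a * a) ≤ P.inner y y := by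
    intro t
    have h1 := hpos (P.right (MulOpposite.op (t • a)) x - y)
    have h2 : P.inner (P.right (MulOpposite.op (t • a)) x - y)
        (P.right (MulOpposite.op (t • a)) x - y) =
        t ^ 2 • (star a * P.inner x x * a) - (2 * t) • (star a * a) + P.inner y y := by
      have hyx : P.inner y x = star a := by rw [ha, P.star_inner]
      simp only [map_sub, LinearMap.sub_apply, P.inner_right, P.inner_right_left, ← ha, hyx,
        star_smul, star_trivial]
      simp only [mul_smul_comm, smul_mul_assoc, smul_smul, two_mul, add_smul, mul_assoc, sq]
      abel
    rw [h2] at h1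
    have h3 : star a * P.inner x x * a ≤ ‖P.inner x x‖ • (star a * a) :=
      CStarAlgebra.star_left_conjugate_le_norm_smul (hb := P.star_inner x x)
    have h4 : t ^ 2 • (star a * P.inner x x * a) ≤ t ^ 2 • (‖P.inner x x‖ • (star a * a)) :=
      smul_le_smul_of_nonneg_left h3 (sq_nonneg t)
    rw [sub_smul, mul_smul (t ^ 2), sub_le_iff_le_add]
    have h5 : (2 * t) • (star a * a) ≤ t ^ 2 • (star a * P.inner x x * a) + P.inner y y := by
      have := add_le_add_left h1 ((2 * t) • (star a * a))
      rw [zero_add] at this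
      refine this.trans (le_of_eq ?_)
      abel
    refine h5.trans ?_
    rw [add_comm]
    exact add_le_add_right h4 _
  have key2 : ∀ ε : ℝ, 0 < ε → ‖a‖ ^ 2 ≤ (‖P.inner x x‖ + ε) * ‖P.inner y y‖ := by
    intro ε hε
    set N := ‖P.inner x x‖
    have hN : 0 ≤ N := norm_nonneg _
    have hNε : 0 < N + ε := by positivity
    have h1 := key (N + ε)⁻¹
    have hc : (N + ε)⁻¹ ≤ 2 * (N + ε)⁻¹ - (N + ε)⁻¹ ^ 2 * N := by
      have : (N + ε)⁻¹ ^ 2 * N ≤ (N + ε)⁻¹ ^ 2 * (N + ε) := by gcongr; linarith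
      have h' : (N + ε)⁻¹ ^ 2 * (N + ε) = (N + ε)⁻¹ := by field_simp
      linarith
    have hc0 : 0 ≤ (N + ε)⁻¹ := by positivity
    have h2 : (N + ε)⁻¹ • (star a * a) ≤ P.inner y y :=
      (smul_le_smul_of_nonneg_right hc (star_mul_self_nonneg a)).trans h1
    have h3 := CStarAlgebra.norm_le_norm_of_nonneg_of_le
      (smul_nonneg hc0 (star_mul_self_nonneg a)) h2
    rw [norm_smul, CStarRing.norm_star_mul_self, Real.norm_of_nonneg hc0,
      inv_mul_le_iff₀ hNε] at h3
    rw [sq]; exact h3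
  refine le_of_forall_pos_le_add fun δ hδ => ?_
  have h := key2 (δ / (‖P.inner y y‖ + 1)) (by positivity)
  refine h.trans ?_
  rw [add_mul]
  gcongr
  rw [div_mul_eq_mul_div, div_le_iff₀ (by positivity)]
  nlinarith [norm_nonneg (P.inner y y)]

theorem norm_inner_le (x y : V) :
    ‖P.inner x y‖ ≤ √‖P.inner x x‖ * √‖P.inner y y‖ := by
  rw [← Real.sqrt_mul (norm_nonneg _)]
  exact Real.le_sqrt_of_sq_le (P.norm_inner_sq_le x y)

theorem norm_right_le (b : B) (x : V) :
    √‖P.inner (P.right (MulOpposite.op b) x) (P.right (MulOpposite.op b) x)‖ ≤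
      ‖b‖ * √‖P.inner x x‖ := by
  rw [P.inner_right, P.inner_right_left]
  refine Real.sqrt_le_iff.2 ⟨by positivity, ?_⟩
  rw [mul_pow, Real.sq_sqrt (norm_nonneg _)]
  calc ‖star b * P.inner x x * b‖ ≤ ‖star b‖ * ‖P.inner x x‖ * ‖b‖ :=
        (norm_mul_le _ _).trans (by gcongr; exact norm_mul_le _ _)
    _ = ‖b‖ ^ 2 * ‖P.inner x x‖ := by rw [norm_star]; ring

theorem norm_left_le (b : B) (x : V) :
    √‖P.inner (P.left b x) (P.left b x)‖ ≤ ‖b‖ * √‖P.inner x x‖ := by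
  let _ := CStarAlgebra.spectralOrder B
  have _ := CStarAlgebra.spectralOrderedRing B
  have hpos : ∀ z, 0 ≤ P.inner z z := fun z =>
    CStarAlgebra.nonneg_iff_eq_star_mul_self.2 (P.inner_self z)
  have hmul : ∀ c d z, P.left c (P.left d z) = P.left (c * d) z := fun c d z => by
    rw [map_mul]; rfl
  have h0 : 0 ≤ ‖b‖ ^ 2 • (1 : B) - star b * b := by
    have h := IsSelfAdjoint.le_algebraMap_norm_self (IsSelfAdjoint.star_mul_self b)
    rw [CStarRing.norm_star_mul_self, Algebra.algebraMap_eq_smul_one, ← sq] at h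
    exact sub_nonneg.2 h
  obtain ⟨c, hc⟩ := CStarAlgebra.nonneg_iff_eq_star_mul_self.1 h0
  set p := P.left 1 x with hp
  have h1 : P.inner (P.left b x) (P.left b x) ≤ ‖b‖ ^ 2 • P.inner p p := by
    rw [← sub_nonneg]
    have h2 : ‖b‖ ^ 2 • P.inner p p - P.inner (P.left b x) (P.left b x) =
        P.inner (P.left c x) (P.left c x) := by
      rw [P.inner_left, P.inner_left, hp, P.inner_left, hmul, hmul, hmul, ← hc, star_one, one_mul,
        map_sub, LinearMap.sub_apply, map_sub]
      congr 1
      rw [← Complex.coe_smul, ← Complex.coe_smul, map_smul]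
      simp
    rw [h2]; exact hpos _
  have h3 : P.inner p p ≤ P.inner x x := by
    rw [← sub_nonneg]
    have hpp : P.inner p p = P.inner x p := by
      rw [hp, P.inner_left, hmul, star_one, one_mul]
    have hpx : P.inner p x = P.inner x p := by
      rw [hp, P.inner_left, star_one]
    have h4 : P.inner x x - P.inner p p = P.inner (x - p) (x - p) := by
      simp only [map_sub, LinearMap.sub_apply, hpp, hpx]
      abel
    rw [h4]; exact hpos _
  have h5 : P.inner (P.left b x) (P.left b x) ≤ ‖b‖ ^ 2 • P.inner x x :=
    h1.trans (smul_le_smul_of_nonneg_left h3 (sq_nonneg _))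
  refine Real.sqrt_le_iff.2 ⟨by positivity, ?_⟩
  rw [mul_pow, Real.sq_sqrt (norm_nonneg _)]
  refine (CStarAlgebra.norm_le_norm_of_nonneg_of_le (hpos _) h5).trans (le_of_eq ?_)
  rw [norm_smul, Real.norm_of_nonneg (sq_nonneg _)]

/-- `V` as a seminormed space, with the seminorm `‖x‖ = ‖⟪x, x⟫‖ ^ (1 / 2)`. -/
def Space (_P : PreCorrespondence B V) : Type u := V

instance : AddCommGroup P.Space := inferInstanceAs (AddCommGroup V)
instance : Module ℂ P.Space := inferInstanceAs (Module ℂ V)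
noncomputable instance : Norm P.Space := ⟨fun x => √‖P.inner (show V from x) (show V from x)‖⟩

theorem norm_space (x : P.Space) : ‖x‖ = √‖P.inner (show V from x) (show V from x)‖ := rfl

theorem seminormedCore : SeminormedSpace.Core ℂ P.Space where
  norm_nonneg x := Real.sqrt_nonneg _
  norm_smul c x := by
    have h : ∀ v : V, √‖P.inner (c • v) (c • v)‖ = ‖c‖ * √‖P.inner v v‖ := fun v => by
      simp only [map_smulₛₗ, LinearMap.smul_apply, norm_smul, RCLike.norm_conj, RingHom.id_apply]
      rw [← mul_assoc, Real.sqrt_mul (by positivity), Real.sqrt_mul_self (norm_nonneg c)]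
    exact h x
  norm_triangle x y := by
    refine Real.sqrt_le_iff.2 ⟨add_nonneg (Real.sqrt_nonneg _) (Real.sqrt_nonneg _), ?_⟩
    change ‖P.inner ((show V from x) + (show V from y)) ((show V from x) + (show V from y))‖ ≤ _
    rw [map_add, map_add, LinearMap.add_apply, LinearMap.add_apply]
    have h1 := P.norm_inner_le x y
    have h2 := P.norm_inner_le y x
    have h3 := Real.sq_sqrt (norm_nonneg (P.inner (show V from x) (show V from x)))
    have h4 := Real.sq_sqrt (norm_nonneg (P.inner (show V from y) (show V from y)))
    rw [norm_space, norm_space]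
    refine (norm_add_le _ _).trans ((add_le_add (norm_add_le _ _) (norm_add_le _ _)).trans ?_)
    nlinarith

noncomputable instance : SeminormedAddCommGroup P.Space := .ofCore P.seminormedCore
noncomputable instance : NormedSpace ℂ P.Space :=
  { norm_smul_le := fun c x => (P.seminormedCore.norm_smul c x).le }

/-- The inner product as a continuous sesquilinear map. -/
noncomputable def innerSL : P.Space →L⋆[ℂ] P.Space →L[ℂ] B :=
  LinearMap.mkContinuous₂ (P.inner : P.Space →ₗ⋆[ℂ] P.Space →ₗ[ℂ] B) 1 fun x y => by
    rw [one_mul]; exact P.norm_inner_le x y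

/-- The right action by bounded operators. -/
noncomputable def rightL (b : B) : P.Space →L[ℂ] P.Space :=
  LinearMap.mkContinuous (P.right (MulOpposite.op b) : P.Space →ₗ[ℂ] P.Space) ‖b‖ fun x =>
    P.norm_right_le b x

/-- The left action by bounded operators. -/
noncomputable def leftL (b : B) : P.Space →L[ℂ] P.Space :=
  LinearMap.mkContinuous (P.left b : P.Space →ₗ[ℂ] P.Space) ‖b‖ fun x => P.norm_left_le b x

theorem innerSL_apply (x y : P.Space) :
    P.innerSL x y = P.inner (show V from x) (show V from y) := rfl

/-- The inner product on the completion. -/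
noncomputable def completionInner : Completion P.Space →L⋆[ℂ] Completion P.Space →L[ℂ] B :=
  ContinuousLinearMap.fromCompletion
    (LinearMap.mkContinuous
      { toFun := fun x => (P.innerSL x).fromCompletion
        map_add' := fun x y => by
          ext z
          induction z using Completion.induction_on with
          | hp => exact isClosed_eq (by fun_prop) (by fun_prop)
          | ih z => simp
        map_smul' := fun c x => by
          ext z
          induction z using Completion.induction_on with
          | hp => exact isClosed_eq (by fun_prop) (by fun_prop)
          | ih z => simp } 1 fun x => by
        refine ContinuousLinearMap.opNorm_le_bound _ (by positivity) fun z => ?_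
        induction z using Completion.induction_on with
        | hp => exact isClosed_le (by fun_prop) (by fun_prop)
        | ih z =>
          simp
          exact P.norm_inner_le x z)

theorem completionInner_coe (x y : P.Space) :
    P.completionInner (x : Completion P.Space) (y : Completion P.Space) =
      P.inner (show V from x) (show V from y) := by
  simp [completionInner]
  rfl

section completion

variable {S : Type u} [SeminormedAddCommGroup S] [NormedSpace ℂ S]

theorem clm_ext {f g : Completion S →L[ℂ] Completion S}
    (h : ∀ z : S, f (z : Completion S) = g (z : Completion S)) : f = g := by
  ext z
  induction z using Completion.induction_on with
  | hp => exact isClosed_eq f.continuous g.continuous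
  | ih z => exact h z

theorem completion_add (f g : S →L[ℂ] S) :
    (f + g).completion = f.completion + g.completion :=
  clm_ext fun z => by simp [Completion.coe_add]

theorem completion_smul (c : ℂ) (f : S →L[ℂ] S) : (c • f).completion = c • f.completion :=
  clm_ext fun z => by simp

theorem completion_zero : (0 : S →L[ℂ] S).completion = 0 :=
  clm_ext fun z => by simp [Completion.coe_zero]

theorem completion_one : (1 : S →L[ℂ] S).completion = 1 := clm_ext fun z => by simp

theorem completion_mul (f g : S →L[ℂ] S) : (f * g).completion = f.completion * g.completion :=
  clm_ext fun z => by simp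

/-- Bounded operators as linear operators. -/
def toEnd (E : Type u) [NormedAddCommGroup E] [NormedSpace ℂ E] :
    (E →L[ℂ] E) →ₐ[ℂ] Module.End ℂ E where
  __ := ContinuousLinearMap.toLinearMapRingHom
  commutes' _ := rfl

end completion

theorem rightL_add (b c : Bᵐᵒᵖ) :
    P.rightL (b + c).unop = P.rightL b.unop + P.rightL c.unop :=
  ContinuousLinearMap.ext fun z => LinearMap.congr_fun (map_add P.right b c) z

theorem rightL_smul (k : ℂ) (b : Bᵐᵒᵖ) : P.rightL (k • b).unop = k • P.rightL b.unop :=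
  ContinuousLinearMap.ext fun z => LinearMap.congr_fun (map_smul P.right k b) z

theorem rightL_one : P.rightL (1 : Bᵐᵒᵖ).unop = 1 :=
  ContinuousLinearMap.ext fun z => LinearMap.congr_fun (map_one P.right) z

theorem rightL_mul (b c : Bᵐᵒᵖ) :
    P.rightL (b * c).unop = P.rightL b.unop * P.rightL c.unop :=
  ContinuousLinearMap.ext fun z => LinearMap.congr_fun (map_mul P.right b c) z

theorem leftL_add (b c : B) : P.leftL (b + c) = P.leftL b + P.leftL c :=
  ContinuousLinearMap.ext fun z => LinearMap.congr_fun (map_add P.left b c) z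

theorem leftL_smul (k : ℂ) (b : B) : P.leftL (k • b) = k • P.leftL b :=
  ContinuousLinearMap.ext fun z => LinearMap.congr_fun (map_smul P.left k b) z

theorem leftL_zero : P.leftL 0 = 0 :=
  ContinuousLinearMap.ext fun z => LinearMap.congr_fun (map_zero P.left) z

theorem leftL_mul (b c : B) : P.leftL (b * c) = P.leftL b * P.leftL c :=
  ContinuousLinearMap.ext fun z => LinearMap.congr_fun (map_mul P.left b c) z

/-- The right action on the completion. -/
noncomputable def completionRight : Bᵐᵒᵖ →ₐ[ℂ] (Completion P.Space →L[ℂ] Completion P.Space) :=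
  AlgHom.ofLinearMap
    { toFun := fun b => (P.rightL b.unop).completion
      map_add' := fun b c => by rw [rightL_add, completion_add]
      map_smul' := fun k b => by rw [rightL_smul, completion_smul, RingHom.id_apply] }
    ((congrArg _ P.rightL_one).trans completion_one)
    (fun b c => (congrArg _ (P.rightL_mul b c)).trans (completion_mul _ _))

/-- The left action on the completion. -/
noncomputable def completionLeft : B →ₙₐ[ℂ] (Completion P.Space →L[ℂ] Completion P.Space) where
  toFun b := (P.leftL b).completion
  map_zero' := by rw [leftL_zero, completion_zero]
  map_add' b c := by rw [leftL_add, completion_add]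
  map_smul' k b := by rw [leftL_smul, completion_smul, MonoidHom.id_apply]
  map_mul' b c := by rw [leftL_mul, completion_mul]

/-- The correspondence obtained from a pre-correspondence by dividing out the vectors of length
zero and completing. -/
noncomputable def complete : Correspondence B where
  carrier := Completion P.Space
  right := (toEnd (Completion P.Space)).comp P.completionRight
  left := (toEnd (Completion P.Space) :
    (Completion P.Space →L[ℂ] Completion P.Space) →ₙₐ[ℂ] _).comp P.completionLeft
  inner := ContinuousLinearMap.coeLM ℂ ∘ₛₗ (P.completionInner : Completion P.Space →ₗ⋆[ℂ] _)
  inner_right x y b := by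
    change P.completionInner x ((P.rightL b).completion y) = P.completionInner x y * b
    induction x, y using Completion.induction_on₂ with
    | hp => exact isClosed_eq (by fun_prop) (by fun_prop)
    | ih x y =>
      rw [ContinuousLinearMap.completion_apply_coe, completionInner_coe, completionInner_coe]
      exact P.inner_right _ _ _
  star_inner x y := by
    change star (P.completionInner x y) = P.completionInner y x
    induction x, y using Completion.induction_on₂ with
    | hp => exact isClosed_eq (by fun_prop) (by fun_prop)
    | ih x y => simpa only [completionInner_coe] using P.star_inner _ _
  inner_self x := by
    change ∃ b, P.completionInner x x = star b * b
    let _ := CStarAlgebra.spectralOrder B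
    have _ := CStarAlgebra.spectralOrderedRing B
    rw [← CStarAlgebra.nonneg_iff_eq_star_mul_self]
    induction x using Completion.induction_on with
    | hp => exact isClosed_le (by fun_prop) (by fun_prop)
    | ih x =>
      rw [completionInner_coe]
      exact CStarAlgebra.nonneg_iff_eq_star_mul_self.2 (P.inner_self _)
  norm_sq x := by
    change ‖x‖ ^ 2 = ‖P.completionInner x x‖
    induction x using Completion.induction_on with
    | hp => exact isClosed_eq (by fun_prop) (by fun_prop)
    | ih x =>
      rw [completionInner_coe, Completion.norm_coe, norm_space, Real.sq_sqrt (norm_nonneg _)]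
  inner_left b x y := by
    change P.completionInner ((P.leftL b).completion x) y =
      P.completionInner x ((P.leftL (star b)).completion y)
    induction x, y using Completion.induction_on₂ with
    | hp => exact isClosed_eq (by fun_prop) (by fun_prop)
    | ih x y =>
      rw [ContinuousLinearMap.completion_apply_coe, ContinuousLinearMap.completion_apply_coe,
        completionInner_coe, completionInner_coe]
      exact P.inner_left _ _ _

/-- The canonical map from a pre-correspondence to its completion. -/
noncomputable def toComplete : V →ₗ[ℂ] P.complete where
  toFun x := ((show P.Space from x : P.Space) : Completion P.Space)
  map_add' x y := Completion.coe_add (α := P.Space) x y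
  map_smul' c x := Completion.coe_smul (X := P.Space) c x

end PreCorrespondence

namespace Correspondence

variable {B : Type u} [CStarAlgebra B]

theorem inner_right_left (E : Correspondence B) (x y : E) (b : B) :
    E.inner (E.right (MulOpposite.op b) x) y = star b * E.inner x y := by
  rw [← E.star_inner, E.inner_right, star_mul, E.star_inner]

/-- A self-adjoint element is a difference of positive elements with product zero. -/
theorem exists_pos_neg {C : Type u} [CStarAlgebra C] [PartialOrder C] [StarOrderedRing C] (X : C)
    (hX : IsSelfAdjoint X) : ∃ P N : C, 0 ≤ P ∧ 0 ≤ N ∧ P - N = X ∧ P * N = 0 :=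
  ⟨X⁺, X⁻, CFC.posPart_nonneg X, CFC.negPart_nonneg X, CFC.posPart_sub_negPart X hX,
    CFC.posPart_mul_negPart X⟩

theorem exists_star_mul_self {C : Type u} [CStarAlgebra C] [PartialOrder C] [StarOrderedRing C]
    {X : C} (hX : 0 ≤ X) : ∃ Y : C, X = star Y * Y :=
  CStarAlgebra.nonneg_iff_eq_star_mul_self.1 hX

/-- The Gram matrix of a finite family in a Hilbert `C⋆`-module is positive. -/
theorem exists_gram (E : Correspondence B) {ι : Type u} [Fintype ι] [DecidableEq ι] (x : ι → E) :
    ∃ Y : ι → ι → B, ∀ i j, E.inner (x i) (x j) = ∑ k, star (Y k i) * Y k j := by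
  let _ := CStarAlgebra.spectralOrder B
  have _ := CStarAlgebra.spectralOrderedRing B
  let X : CStarMatrix ι ι B := CStarMatrix.ofMatrix fun i j => E.inner (x i) (x j)
  have hX : IsSelfAdjoint X := by
    ext i j
    exact E.star_inner _ _
  obtain ⟨P, N, hP, hN, hPN, hPN0⟩ := exists_pos_neg X hX
  have hNs : IsSelfAdjoint N := hN.isSelfAdjoint
  have hN3 : N * X * N = -(N * N * N) := by
    calc N * X * N = N * (P - N) * N := by rw [hPN]
      _ = N * (P * N) - N * N * N := by rw [mul_sub, sub_mul, mul_assoc N P N]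
      _ = _ := by rw [hPN0, mul_zero, zero_sub]
  have hdiag1 : ∀ j, 0 ≤ (N * X * N) j j := by
    intro j
    have h : (N * X * N) j j =
        E.inner (∑ i, E.right (MulOpposite.op (N i j)) (x i))
          (∑ i, E.right (MulOpposite.op (N i j)) (x i)) := by
      simp only [map_sum, LinearMap.sum_apply, E.inner_right, inner_right_left]
      rw [CStarMatrix.mul_apply]
      refine Finset.sum_congr rfl fun k _ => ?_
      rw [CStarMatrix.mul_apply, Finset.sum_mul]
      refine Finset.sum_congr rfl fun i _ => ?_
      have : star (N i j) = N j i := CStarMatrix.star_apply_of_isSelfAdjoint hNs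
      rw [this]
      rfl
    rw [h]
    exact CStarAlgebra.nonneg_iff_eq_star_mul_self.2 (E.inner_self _)
  have hNnn : 0 ≤ N * N * N := by
    have h := star_left_conjugate_nonneg hN N
    rwa [hNs.star_eq] at h
  obtain ⟨Z, hZ⟩ := exists_star_mul_self hNnn
  have hZ0 : Z = 0 := by
    ext k j
    have h1 : (N * N * N) j j = ∑ k, star (Z k j) * Z k j := by
      rw [hZ, CStarMatrix.mul_apply]
      rfl
    have h2 : (N * N * N) j j ≤ 0 := by
      have := hdiag1 j
      rw [hN3, CStarMatrix.neg_apply] at this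
      exact neg_nonneg.1 this
    rw [h1] at h2
    have h3 : ∀ k ∈ Finset.univ, 0 ≤ star (Z k j) * Z k j := fun k _ => star_mul_self_nonneg _
    have h4 := (Finset.sum_eq_zero_iff_of_nonneg h3).1
      (le_antisymm h2 (Finset.sum_nonneg h3)) k (Finset.mem_univ k)
    exact (CStarRing.star_mul_self_eq_zero_iff _).1 h4
  have hN0 : N = 0 := by
    have h1 : N * N * N = 0 := by rw [hZ, hZ0, mul_zero]
    have h2 : star (N * N) * (N * N) = 0 := by
      rw [star_mul, hNs.star_eq, ← mul_assoc, h1, zero_mul]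
    have h3 := (CStarRing.star_mul_self_eq_zero_iff _).1 h2
    refine (CStarRing.star_mul_self_eq_zero_iff N).1 ?_
    rw [hNs.star_eq, h3]
  have hXnn : 0 ≤ X := by
    rw [← hPN, hN0, sub_zero]
    exact hP
  obtain ⟨Y, hY⟩ := exists_star_mul_self hXnn
  refine ⟨fun i j => Y i j, fun i j => ?_⟩
  change X i j = _
  rw [hY, CStarMatrix.mul_apply]
  rfl

variable (E F : Correspondence B)

/-- The inner product on the algebraic tensor product, given on simple tensors by
`⟪x ⊗ y, x' ⊗ y'⟫ = ⟪y, ⟪x, x'⟫ · y'⟫`. -/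
noncomputable def tensorInner : E ⊗[ℂ] F →ₗ⋆[ℂ] E ⊗[ℂ] F →ₗ[ℂ] B :=
  TensorProduct.lift <| LinearMap.mk₂'ₛₗ (starRingEnd ℂ) (starRingEnd ℂ)
    (fun (x : E) (y : F) => TensorProduct.lift <| LinearMap.mk₂ ℂ
      (fun (x' : E) (y' : F) => F.inner y (F.left (E.inner x x') y'))
      (fun _ _ _ => by simp) (fun _ _ _ => by simp) (fun _ _ _ => by simp)
      (fun _ _ _ => by simp))
    (fun _ _ _ => TensorProduct.ext' fun _ _ => by simp)
    (fun _ _ _ => TensorProduct.ext' fun _ _ => by simp)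
    (fun _ _ _ => TensorProduct.ext' fun _ _ => by simp)
    (fun _ _ _ => TensorProduct.ext' fun _ _ => by simp)

theorem tensorInner_tmul (x x' : E) (y y' : F) :
    tensorInner E F (x ⊗ₜ y) (x' ⊗ₜ y') = F.inner y (F.left (E.inner x x') y') := rfl

theorem left_left (b c : B) (x : E) : E.left b (E.left c x) = E.left (b * c) x := by
  rw [map_mul]; rfl

/-- The algebraic tensor product `E ⊗ F` over `ℂ` with the actions `b (x ⊗ y) = (b x) ⊗ y`,
`(x ⊗ y) b = x ⊗ (y b)` and the semi-inner product `⟪x ⊗ y, x' ⊗ y'⟫ = ⟪y, ⟪x, x'⟫ · y'⟫`. -/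
noncomputable def algTensor : PreCorrespondence B (E ⊗[ℂ] F) where
  right := (Module.End.lTensorAlgHom ℂ F E).comp F.right
  left := (Module.End.rTensorAlgHom ℂ E F : Module.End ℂ E →ₙₐ[ℂ] _).comp E.left
  inner := tensorInner E F
  inner_right x y b := by
    induction x with
    | zero => simp
    | add x x' hx hx' => simp only [map_add, LinearMap.add_apply, hx, hx', add_mul]
    | tmul x₁ x₂ =>
      induction y with
      | zero => simp
      | add y y' hy hy' => simp only [map_add, hy, hy', add_mul]
      | tmul y₁ y₂ =>
        change F.inner x₂ (F.left (E.inner x₁ y₁) (F.right (MulOpposite.op b) y₂)) =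
          F.inner x₂ (F.left (E.inner x₁ y₁) y₂) * b
        have h := F.inner_left (star (E.inner x₁ y₁)) x₂
        rw [star_star] at h
        rw [← h, ← h, F.inner_right]
  star_inner x y := by
    induction x with
    | zero => simp
    | add x x' hx hx' => simp only [map_add, LinearMap.add_apply, star_add, hx, hx']
    | tmul x₁ x₂ =>
      induction y with
      | zero => simp
      | add y y' hy hy' => simp only [map_add, LinearMap.add_apply, star_add, hy, hy']
      | tmul y₁ y₂ =>
        rw [tensorInner_tmul, tensorInner_tmul, F.star_inner, F.inner_left, E.star_inner]
  inner_self z := by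
    classical
    obtain ⟨S, rfl⟩ := TensorProduct.exists_finset z
    obtain ⟨Y, hY⟩ := E.exists_gram (fun i : S => i.1.1)
    let _ := CStarAlgebra.spectralOrder B
    have _ := CStarAlgebra.spectralOrderedRing B
    have h : ∀ k : S, 0 ≤ F.inner (∑ i : S, F.left (Y k i) i.1.2) (∑ i : S, F.left (Y k i) i.1.2) :=
      fun k => CStarAlgebra.nonneg_iff_eq_star_mul_self.2 (F.inner_self _)
    refine CStarAlgebra.nonneg_iff_eq_star_mul_self.1 ?_
    convert Finset.sum_nonneg fun k (_ : k ∈ Finset.univ) => h k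
    rw [← Finset.sum_coe_sort S]
    simp only [map_sum, LinearMap.sum_apply, tensorInner_tmul, hY, F.inner_left, left_left]
    conv_rhs => rw [Finset.sum_comm]
    refine Finset.sum_congr rfl fun i _ => ?_
    rw [Finset.sum_comm]
  inner_left b x y := by
    induction x with
    | zero => simp
    | add x x' hx hx' => simp only [map_add, LinearMap.add_apply, hx, hx']
    | tmul x₁ x₂ =>
      induction y with
      | zero => simp
      | add y y' hy hy' => simp only [map_add, hy, hy']
      | tmul y₁ y₂ =>
        change F.inner x₂ (F.left (E.inner (E.left b x₁) y₁) y₂) =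
          F.inner x₂ (F.left (E.inner x₁ (E.left (star b) y₁)) y₂)
        rw [E.inner_left]

/-- The interior tensor product `E ⊗̂ F`. -/
noncomputable def tensor : Correspondence B := (algTensor E F).complete

/-- The `C⋆`-algebra `B` as a correspondence over itself. -/
noncomputable def self (B : Type u) [CStarAlgebra B] : Correspondence B where
  carrier := B
  right := Algebra.lsmul ℂ ℂ B
  inner := LinearMap.mk₂'ₛₗ (starRingEnd ℂ) (RingHom.id ℂ) (fun x y => star x * y)
    (fun _ _ _ => by rw [star_add, add_mul]) (fun _ _ _ => by simp)
    (fun _ _ _ => mul_add _ _ _) (fun _ _ _ => by simp)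
  inner_right x y b := (mul_assoc (star x) y b).symm
  star_inner x y := by simp
  inner_self x := ⟨x, rfl⟩
  norm_sq x := by simp [CStarRing.norm_star_mul_self, sq]
  left := (Algebra.lmul ℂ B : B →ₙₐ[ℂ] _)
  inner_left b x y := by
    change star (b * x) * y = star x * (star b * y)
    rw [star_mul, mul_assoc]

/-- The `n`-fold interior tensor power of a correspondence, which is `B` for `n = 0`. -/
noncomputable def tensorPower (E : Correspondence B) : ℕ → Correspondence B
  | 0 => self B
  | 1 => E
  | n + 2 => tensor (tensorPower E (n + 1)) E

/-- The simple tensor `x ⊗ y` in the interior tensor product. -/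
noncomputable def tmul (x : E) (y : F) : tensor E F := (algTensor E F).toComplete (x ⊗ₜ[ℂ] y)

/-- The simple tensor `x₁ ⊗ ⋯ ⊗ xₙ` in the `n`-fold interior tensor power. -/
noncomputable def simpleTensor (E : Correspondence B) :
    (n : ℕ) → (Fin n → E) → tensorPower E n
  | 0, _ => (1 : B)
  | 1, x => x 0
  | n + 2, x => tmul (tensorPower E (n + 1)) E (simpleTensor E (n + 1) (Fin.init x))
      (x (Fin.last (n + 1)))

end Correspondence

/-- A unitary isomorphism of right Hilbert `C⋆`-modules, whose coefficient algebras are identified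
by `κ`: a linear bijection which preserves the inner products and the right actions. -/
structure UnitaryEquiv {B C : Type u} [CStarAlgebra B] [CStarAlgebra C] (κ : B ≃⋆ₐ[ℂ] C)
    (E : HilbertModule B) (F : HilbertModule C) extends E ≃ₗ[ℂ] F where
  inner_map : ∀ x y, F.inner (toLinearEquiv x) (toLinearEquiv y) = κ (E.inner x y)
  map_right : ∀ x b, toLinearEquiv (E.right (MulOpposite.op b) x) =
    F.right (MulOpposite.op (κ b)) (toLinearEquiv x)

/-- A strongly continuous action of the circle on a `C⋆`-algebra by `*`-automorphisms. -/
structure CircleAction (A : Type u) [CStarAlgebra A] where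
  toHom : Circle →* (A ≃⋆ₐ[ℂ] A)
  continuous : ∀ a, Continuous fun z => toHom z a

namespace CircleAction

variable {A : Type u} [CStarAlgebra A] (σ : CircleAction A)

/-- The spectral subspace `{x | σ_z x = z⁻ⁿ x for all z}`. -/
def spectral (n : ℤ) : Submodule ℂ A where
  carrier := {x | ∀ z : Circle, σ.toHom z x = (z : ℂ) ^ (-n) • x}
  add_mem' hx hy z := by rw [map_add, hx z, hy z, smul_add]
  zero_mem' z := by rw [map_zero, smul_zero]
  smul_mem' c x hx z := by rw [map_smul, hx z, smul_comm]

variable {σ}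

theorem mem_spectral {n : ℤ} {x : A} :
    x ∈ σ.spectral n ↔ ∀ z : Circle, σ.toHom z x = (z : ℂ) ^ (-n) • x := Iff.rfl

theorem mem_spectral_zero {x : A} : x ∈ σ.spectral 0 ↔ ∀ z : Circle, σ.toHom z x = x := by
  simp [mem_spectral]

theorem mul_mem_spectral {m n k : ℤ} (h : m + n = k) {x y : A} (hx : x ∈ σ.spectral m)
    (hy : y ∈ σ.spectral n) : x * y ∈ σ.spectral k := fun z => by
  rw [map_mul, hx z, hy z, smul_mul_smul_comm, ← zpow_add₀ (Circle.coe_ne_zero z), ← h, neg_add]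

theorem star_mem_spectral {m n : ℤ} (h : -m = n) {x : A} (hx : x ∈ σ.spectral m) :
    star x ∈ σ.spectral n := fun z => by
  rw [map_star, hx z, star_smul, ← h, star_zpow₀, Complex.star_def, ← Circle.coe_inv_eq_conj,
    Circle.coe_inv, inv_zpow', neg_neg]

theorem isClosed_spectral (n : ℤ) : IsClosed (σ.spectral n : Set A) := by
  have : (σ.spectral n : Set A) = ⋂ z : Circle, {x | σ.toHom z x = (z : ℂ) ^ (-n) • x} := by
    ext x; simp [mem_spectral]
  rw [this]
  exact isClosed_iInter fun z => isClosed_eq (StarAlgEquiv.isometry (σ.toHom z)).continuous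
    (continuous_const_smul _)

variable (σ)

/-- The fixed point algebra, that is the spectral subspace of index `0`. -/
def fixed : StarSubalgebra ℂ A where
  carrier := σ.spectral 0
  add_mem' := add_mem
  mul_mem' hx hy := mul_mem_spectral (add_zero 0) hx hy
  algebraMap_mem' c := mem_spectral_zero.2 fun z => by
    rw [Algebra.algebraMap_eq_smul_one, map_smul, map_one]
  star_mem' hx := star_mem_spectral neg_zero hx

instance : IsClosed (σ.fixed : Set A) := isClosed_spectral 0

instance (n : ℤ) : CompleteSpace (σ.spectral n) := (isClosed_spectral n).completeSpace_coe

variable {σ} in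
theorem exists_fixed {n : ℤ} (x : σ.spectral n) :
    ∃ b : σ.fixed, (star (x : A) * (x : A)) = star (b : A) * b := by
  let _ := CStarAlgebra.spectralOrder A
  have _ := CStarAlgebra.spectralOrderedRing A
  set a : A := star (x : A) * x with ha
  have ha0 : 0 ≤ a := star_mul_self_nonneg _
  have haf : a ∈ σ.spectral 0 := mul_mem_spectral (neg_add_cancel n) (star_mem_spectral rfl x.2) x.2
  have hs : CFC.sqrt a * CFC.sqrt a = a := CFC.sqrt_mul_sqrt_self a ha0
  have h0 : 0 ≤ CFC.sqrt a := CFC.sqrt_nonneg a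
  refine ⟨⟨CFC.sqrt a, mem_spectral_zero.2 fun z => ?_⟩, ?_⟩
  · refine (CFC.sqrt_unique (a := a) ?_ ?_).symm
    · rw [← map_mul, hs]
      exact mem_spectral_zero.1 haf z
    · exact map_nonneg _ h0
  · change a = star (CFC.sqrt a) * CFC.sqrt a
    rw [h0.isSelfAdjoint.star_eq, hs]

/-- The spectral subspace `A₍ₙ₎` as a correspondence over the fixed point algebra, with the actions
given by multiplication and the inner product `⟪x, y⟫ = x⋆ y`. -/
noncomputable def spectralModule (n : ℤ) : Correspondence σ.fixed where
  carrier := σ.spectral n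
  right := AlgHom.ofLinearMap
    (LinearMap.mk₂ ℂ
      (fun (b : σ.fixedᵐᵒᵖ) (x : σ.spectral n) =>
        (⟨(x : A) * (b.unop : A), mul_mem_spectral (add_zero n) x.2 b.unop.2⟩ : σ.spectral n))
      (fun _ _ _ => Subtype.ext (by simp [mul_add])) (fun _ _ _ => Subtype.ext (by simp))
      (fun _ _ _ => Subtype.ext (by simp [add_mul])) (fun _ _ _ => Subtype.ext (by simp)))
    (LinearMap.ext fun _ => Subtype.ext (by simp))
    (fun _ _ => LinearMap.ext fun _ => Subtype.ext (by simp [mul_assoc]))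
  inner := LinearMap.mk₂'ₛₗ (starRingEnd ℂ) (RingHom.id ℂ)
    (fun x y => ⟨star (x : A) * (y : A),
      mul_mem_spectral (neg_add_cancel n) (star_mem_spectral rfl x.2) y.2⟩)
    (fun _ _ _ => Subtype.ext (by simp [add_mul])) (fun _ _ _ => Subtype.ext (by simp))
    (fun _ _ _ => Subtype.ext (by simp [mul_add])) (fun _ _ _ => Subtype.ext (by simp))
  inner_right x y b := Subtype.ext (by simp [mul_assoc])
  star_inner x y := Subtype.ext (by simp)
  inner_self x := (exists_fixed x).imp fun b hb => Subtype.ext hb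
  norm_sq x := by
    change ‖(x : A)‖ ^ 2 = ‖star (x : A) * (x : A)‖
    rw [CStarRing.norm_star_mul_self, sq]
  left :=
    { toFun := fun b =>
        { toFun := fun x => ⟨(b : A) * (x : A), mul_mem_spectral (zero_add n) b.2 x.2⟩
          map_add' := fun _ _ => Subtype.ext (by simp [mul_add])
          map_smul' := fun _ _ => Subtype.ext (by simp) }
      map_zero' := LinearMap.ext fun _ => Subtype.ext (by simp)
      map_add' := fun _ _ => LinearMap.ext fun _ => Subtype.ext (by simp [add_mul])
      map_smul' := fun _ _ => LinearMap.ext fun _ => Subtype.ext (by simp)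
      map_mul' := fun _ _ => LinearMap.ext fun _ => Subtype.ext (by simp [mul_assoc]) }
  inner_left b x y := Subtype.ext (by simp [mul_assoc])

/-- The inclusion of the spectral subspace `A₍ₙ₎` into `A`. -/
noncomputable def inclusion (n : ℤ) : σ.spectralModule n →ₗ[ℂ] A := (σ.spectral n).subtype

/-- The action is semi-saturated if `A` is generated as a `C⋆`-algebra by the fixed point algebra
and the first spectral subspace. -/
def IsSemiSaturated : Prop :=
  (StarAlgebra.adjoin ℂ ((σ.spectral 0 : Set A) ∪ (σ.spectral 1 : Set A))).topologicalClosure = ⊤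

end CircleAction

/-- A `ℤ`-graded unital `*`-algebra `𝒜 = ⨁ 𝒜₍ₙ₎`, realized as a dense unital `*`-subalgebra of the
`C⋆`-algebra `A` (so that `A` is the completion of `𝒜` in the restricted `C⋆`-norm), such that
`‖σ_w x‖ ≤ ‖x‖` for `w` in the circle and `x` in `𝒜`, where `σ_w x = w⁻ⁿ x` on `𝒜₍ₙ₎`. -/
structure CircleGrading (A : Type u) [CStarAlgebra A] where
  gr : ℤ → Submodule ℂ A
  one_mem : 1 ∈ gr 0
  mul_mem : ∀ {m n x y}, x ∈ gr m → y ∈ gr n → x * y ∈ gr (m + n)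
  star_mem : ∀ {n x}, x ∈ gr n → star x ∈ gr (-n)
  indep : iSupIndep gr
  dense : Dense ((⨆ n, gr n : Submodule ℂ A) : Set A)
  norm_le : ∀ (w : Circle) (s : Finset ℤ) (x : ℤ → A), (∀ n, x n ∈ gr n) →
    ‖∑ n ∈ s, (w : ℂ) ^ (-n) • x n‖ ≤ ‖∑ n ∈ s, x n‖

namespace CircleGrading

variable {A : Type u} [CStarAlgebra A] (G : CircleGrading A)

/-- The inclusion of `⨁ 𝒜₍ₙ₎` into `A`. -/
noncomputable def incl : (Π₀ n, G.gr n) →ₗ[ℂ] A := DFinsupp.lsum ℕ fun n => (G.gr n).subtype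

/-- The map `σ_w` on `⨁ 𝒜₍ₙ₎`, with values in `A`. -/
noncomputable def preAct (w : Circle) : (Π₀ n, G.gr n) →ₗ[ℂ] A :=
  DFinsupp.lsum ℕ fun n => (w : ℂ) ^ (-n) • (G.gr n).subtype

theorem denseRange_incl : DenseRange G.incl := by
  have h : (LinearMap.range G.incl : Set A) = Set.range G.incl := rfl
  rw [DenseRange, ← h]
  have : LinearMap.range G.incl = ⨆ n, G.gr n := (Submodule.iSup_eq_range_dfinsupp_lsum G.gr).symm
  rw [this]
  exact G.dense

theorem norm_preAct_le (w : Circle) (x : Π₀ n, G.gr n) : ‖G.preAct w x‖ ≤ 1 * ‖G.incl x‖ := by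
  classical
  have h := G.norm_le w x.support (fun n => x n) (fun n => (x n).2)
  rw [one_mul, incl, preAct, DFinsupp.lsum_apply_apply, DFinsupp.lsum_apply_apply,
    DFinsupp.sumAddHom_apply, DFinsupp.sumAddHom_apply]
  exact h

/-- The extension of `σ_w` to `A` by continuity. -/
noncomputable def extAct (w : Circle) : A →L[ℂ] A := (G.preAct w).extendOfNorm G.incl

theorem norm_extAct_le (w : Circle) (x : A) : ‖G.extAct w x‖ ≤ ‖x‖ := by
  exact (LinearMap.norm_extendOfNorm_apply_le G.denseRange_incl 1 (G.norm_preAct_le w) x).trans_eq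
    (one_mul _)

theorem extAct_of_mem (w : Circle) {n : ℤ} {x : A} (hx : x ∈ G.gr n) :
    G.extAct w x = (w : ℂ) ^ (-n) • x := by
  classical
  have h := LinearMap.extendOfNorm_eq G.denseRange_incl ⟨1, G.norm_preAct_le w⟩
    (DFinsupp.single n ⟨x, hx⟩)
  have h1 : G.incl (DFinsupp.single n ⟨x, hx⟩) = x := by simp [incl]
  have h2 : G.preAct w (DFinsupp.single n ⟨x, hx⟩) = (w : ℂ) ^ (-n) • x := by simp [preAct]
  rw [h1, h2] at h
  exact h

variable {G} in
theorem add_ext {M : Type u} [AddMonoid M] [TopologicalSpace M] [T2Space M] {f g : A →+ M}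
    (hf : Continuous f) (hg : Continuous g) (h : ∀ n, ∀ x ∈ G.gr n, f x = g x) : f = g := by
  ext x
  refine congrFun (Continuous.ext_on G.dense hf hg fun y hy => ?_) x
  induction hy using Submodule.iSup_induction' with
  | mem n y hy => exact h n y hy
  | zero => simp
  | add y z _ _ hy hz => rw [map_add, map_add, hy, hz]

theorem extAct_mul (w : Circle) (x y : A) : G.extAct w (x * y) = G.extAct w x * G.extAct w y := by
  have h1 : ∀ n, ∀ x ∈ G.gr n, ∀ y, G.extAct w (x * y) = G.extAct w x * G.extAct w y := by
    intro n x hx y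
    refine DFunLike.congr_fun (add_ext (G := G)
      (f := (G.extAct w : A →+ A).comp (AddMonoidHom.mulLeft x))
      (g := (AddMonoidHom.mulLeft (G.extAct w x)).comp (G.extAct w : A →+ A)) ?_ ?_ ?_) y
    · exact (G.extAct w).continuous.comp (continuous_const_mul x)
    · exact (continuous_const_mul _).comp (G.extAct w).continuous
    · intro m y hy
      change G.extAct w (x * y) = G.extAct w x * G.extAct w y
      rw [G.extAct_of_mem w hx, G.extAct_of_mem w hy, G.extAct_of_mem w (G.mul_mem hx hy),
        smul_mul_smul_comm, ← zpow_add₀ (Circle.coe_ne_zero w), neg_add]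
  refine DFunLike.congr_fun (add_ext (G := G)
      (f := (G.extAct w : A →+ A).comp (AddMonoidHom.mulRight y))
      (g := (AddMonoidHom.mulRight (G.extAct w y)).comp (G.extAct w : A →+ A)) ?_ ?_ ?_) x
  · exact (G.extAct w).continuous.comp (continuous_mul_const y)
  · exact (continuous_mul_const _).comp (G.extAct w).continuous
  · intro n x hx
    exact h1 n x hx y

theorem extAct_star (w : Circle) (x : A) : G.extAct w (star x) = star (G.extAct w x) := by
  refine DFunLike.congr_fun (add_ext (G := G)
      (f := (G.extAct w : A →+ A).comp (starAddEquiv : A ≃+ A))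
      (g := ((starAddEquiv : A ≃+ A) : A →+ A).comp (G.extAct w : A →+ A)) ?_ ?_ ?_) x
  · exact (G.extAct w).continuous.comp continuous_star
  · exact continuous_star.comp (G.extAct w).continuous
  · intro n x hx
    change G.extAct w (star x) = star (G.extAct w x)
    rw [G.extAct_of_mem w hx, G.extAct_of_mem w (G.star_mem hx), star_smul, star_zpow₀,
      Complex.star_def, ← Circle.coe_inv_eq_conj, Circle.coe_inv, inv_zpow']

theorem extAct_comp (w z : Circle) (x : A) : G.extAct (w * z) x = G.extAct w (G.extAct z x) := by
  refine DFunLike.congr_fun (add_ext (G := G)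
      (f := (G.extAct (w * z) : A →+ A))
      (g := (G.extAct w : A →+ A).comp (G.extAct z : A →+ A)) ?_ ?_ ?_) x
  · exact (G.extAct _).continuous
  · exact (G.extAct w).continuous.comp (G.extAct z).continuous
  · intro n x hx
    change G.extAct (w * z) x = G.extAct w (G.extAct z x)
    rw [G.extAct_of_mem z hx, map_smul, G.extAct_of_mem w hx, G.extAct_of_mem _ hx, smul_smul,
      Circle.coe_mul, mul_zpow, mul_comm]

theorem extAct_one (x : A) : G.extAct 1 x = x := by
  refine DFunLike.congr_fun (add_ext (G := G)
      (f := (G.extAct 1 : A →+ A)) (g := AddMonoidHom.id A) ?_ ?_ ?_) x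
  · exact (G.extAct _).continuous
  · exact continuous_id
  · intro n x hx
    change G.extAct 1 x = x
    rw [G.extAct_of_mem 1 hx]
    simp

theorem continuous_extAct (x : A) : Continuous fun w => G.extAct w x := by
  refine continuous_of_uniform_approx_of_continuous fun u hu => ?_
  obtain ⟨ε, hε, hu⟩ := Metric.mem_uniformity_dist.1 hu
  obtain ⟨y, hy, hxy⟩ := Metric.mem_closure_iff.1 (G.dense x) ε hε
  refine ⟨fun w => G.extAct w y, ?_, fun w => hu ?_⟩
  · clear hxy
    induction hy using Submodule.iSup_induction' with
    | mem n y hy =>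
      simp only [G.extAct_of_mem _ hy]
      refine Continuous.smul ?_ continuous_const
      exact Continuous.zpow₀ continuous_subtype_val _ fun w => Or.inl (Circle.coe_ne_zero w)
    | zero => simpa using continuous_const
    | add y z _ _ hy hz => simp only [map_add]; exact hy.add hz
  · rw [dist_eq_norm, ← map_sub]
    exact (G.norm_extAct_le w _).trans_lt (by rwa [← dist_eq_norm])

/-- The circle action on `A` extending `σ_w x = w⁻ⁿ x` for `x` in `𝒜₍ₙ₎` by continuity. -/
noncomputable def action : CircleAction A where
  toHom :=
    { toFun := fun w =>
        { toFun := G.extAct w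
          invFun := G.extAct w⁻¹
          left_inv := fun x => by rw [← extAct_comp, inv_mul_cancel, extAct_one]
          right_inv := fun x => by rw [← extAct_comp, mul_inv_cancel, extAct_one]
          map_mul' := G.extAct_mul w
          map_add' := map_add _
          map_star' := G.extAct_star w
          map_smul' := map_smul _ }
      map_one' := StarAlgEquiv.ext G.extAct_one
      map_mul' := fun w z => StarAlgEquiv.ext (G.extAct_comp w z) }
  continuous := G.continuous_extAct

theorem action_apply (w : Circle) {n : ℤ} {x : A} (hx : x ∈ G.gr n) :
    G.action.toHom w x = (w : ℂ) ^ (-n) • x := G.extAct_of_mem w hx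

/-- The `*`-subalgebra `⨁ 𝒜₍ₙ_d₎` of `𝒜`. -/
def rootSubalgebra (d : ℕ) : StarSubalgebra ℂ A where
  carrier := (⨆ n : ℤ, G.gr (n * d) : Submodule ℂ A)
  add_mem' := add_mem
  mul_mem' {x y} hx hy := by
    induction hx using Submodule.iSup_induction' with
    | mem m x hx =>
      induction hy using Submodule.iSup_induction' with
      | mem n y hy =>
        refine Submodule.mem_iSup_of_mem (m + n) ?_
        rw [add_mul]
        exact G.mul_mem hx hy
      | zero => rw [mul_zero]; exact zero_mem _
      | add y z _ _ hy hz => rw [mul_add]; exact add_mem hy hz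
    | zero => rw [zero_mul]; exact zero_mem _
    | add x z _ _ hx hz => rw [add_mul]; exact add_mem hx hz
  algebraMap_mem' c := by
    rw [Algebra.algebraMap_eq_smul_one]
    refine Submodule.smul_mem _ c (Submodule.mem_iSup_of_mem 0 ?_)
    rw [zero_mul]
    exact G.one_mem
  star_mem' {x} hx := by
    induction hx using Submodule.iSup_induction' with
    | mem n x hx =>
      refine Submodule.mem_iSup_of_mem (-n) ?_
      rw [neg_mul]
      exact G.star_mem hx
    | zero => rw [star_zero]; exact zero_mem _
    | add x z _ _ hx hz => rw [star_add]; exact add_mem hx hz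

/-- The `C⋆`-algebra `A^{1/d}`: the completion (closure in `A`) of `⨁ 𝒜₍ₙ_d₎`. -/
def rootAlgebra (d : ℕ) : StarSubalgebra ℂ A := (G.rootSubalgebra d).topologicalClosure

instance (d : ℕ) : IsClosed (G.rootAlgebra d : Set A) :=
  StarSubalgebra.isClosed_topologicalClosure _

theorem gr_le_rootAlgebra (d : ℕ) (n : ℤ) {x : A} (hx : x ∈ G.gr (n * d)) :
    x ∈ G.rootAlgebra d :=
  (G.rootSubalgebra d).le_topologicalClosure (Submodule.mem_iSup_of_mem n hx)

/-- The grading `(𝒜^{1/d})₍ₙ₎ = 𝒜₍ₙ_d₎` on `𝒜^{1/d}` as a dense `*`-subalgebra of `A^{1/d}`. -/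
noncomputable def root (d : ℕ) [NeZero d] : CircleGrading (G.rootAlgebra d) where
  gr n := (G.gr (n * d)).comap (G.rootAlgebra d).subtype.toLinearMap
  one_mem := by
    change (1 : A) ∈ G.gr (0 * d)
    rw [zero_mul]
    exact G.one_mem
  mul_mem {m n x y} hx hy := by
    change (x : A) * (y : A) ∈ G.gr ((m + n) * d)
    rw [add_mul]
    exact G.mul_mem hx hy
  star_mem {n x} hx := by
    change star (x : A) ∈ G.gr (-n * d)
    rw [neg_mul]
    exact G.star_mem hx
  indep := by
    have hd : (d : ℤ) ≠ 0 := Nat.cast_ne_zero.2 (NeZero.ne d)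
    have h := G.indep.comp (mul_left_injective₀ hd)
    rw [iSupIndep_iff_finsetSum_eq_zero_imp_eq_zero] at h ⊢
    intro s v hv hs n hn
    refine Subtype.ext (h s (fun n => (v n : A)) hv ?_ n hn)
    have := congrArg (G.rootAlgebra d).subtype hs
    rwa [map_sum, map_zero] at this
  dense := by
    rw [Subtype.dense_iff]
    intro x hx
    refine closure_mono ?_ hx
    intro y hy
    change y ∈ (⨆ n : ℤ, G.gr (n * d) : Submodule ℂ A) at hy
    induction hy using Submodule.iSup_induction' with
    | mem n y hy => exact ⟨⟨y, G.gr_le_rootAlgebra d n hy⟩, Submodule.mem_iSup_of_mem n hy, rfl⟩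
    | zero => exact ⟨0, zero_mem _, rfl⟩
    | add y z _ _ hy hz =>
      obtain ⟨y', hy', rfl⟩ := hy
      obtain ⟨z', hz', rfl⟩ := hz
      exact ⟨y' + z', add_mem hy' hz', rfl⟩
  norm_le w s x hx := by
    have hd : (d : ℤ) ≠ 0 := Nat.cast_ne_zero.2 (NeZero.ne d)
    obtain ⟨z, rfl⟩ : ∃ z : Circle, z ^ d = w := by
      obtain ⟨t, rfl⟩ := Circle.exp_surjective w
      refine ⟨Circle.exp (t / d), ?_⟩
      rw [← Circle.exp_nsmul, nsmul_eq_mul, mul_div_cancel₀ _ (Nat.cast_ne_zero.2 (NeZero.ne d))]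
    let y : ℤ → A := fun m => if (m / d) * d = m then (x (m / d) : A) else 0
    have hy : ∀ n, y (n * d) = x n := fun n => by
      simp [y, Int.mul_ediv_cancel n hd]
    have h := G.norm_le z (s.map ⟨fun n => n * d, mul_left_injective₀ hd⟩) y fun m => by
      by_cases hm : (m / d) * d = m
      · simp only [y, if_pos hm]
        have := hx (m / d)
        change (x (m / d) : A) ∈ G.gr (m / d * d) at this
        rwa [hm] at this
      · simp only [y, if_neg hm]
        exact zero_mem _
    rw [Finset.sum_map, Finset.sum_map] at h
    simp only [Function.Embedding.coeFn_mk, hy] at h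
    change ‖(G.rootAlgebra d).subtype _‖ ≤ ‖(G.rootAlgebra d).subtype _‖
    rw [map_sum, map_sum]
    refine le_trans (le_of_eq ?_) h
    congr 1
    refine Finset.sum_congr rfl fun n _ => ?_
    change ((z ^ d : Circle) : ℂ) ^ (-n) • (x n : A) = _
    rw [Circle.coe_pow, ← zpow_natCast, ← zpow_mul]
    congr 2
    ring

end CircleGrading

end Pimsner

/-! Multiplication preserves inner products: for `x, x'` in a spectral subspace and `y, y'` in
another, `(x y)⋆ (x' y') = y⋆ ⟪x, x'⟫ y'`, which is exactly the inner product of the interior tensor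
product. The product map is therefore well defined on the quotient, isometric on the completion, and
has closed range (`exists_product_map`). What remains is surjectivity: the algebraic power `A₍ε₎ᵈ`
must be dense in `A₍εd₎` for `ε = ±1`.

Density is where semi-saturation enters. Products of adjacent factors of degrees `1` and `-1` fall
into `A₍₀₎`, so every word in the generators and their adjoints reduces to one in which only a
single sign occurs. The generated `*`-algebra thus lies in a graded sum `words` whose pieces of
degree `±n`, `n ≥ 1`, are contained in `A₍±1₎ⁿ`. Density of the whole sum in `A` passes to each
degree through `mem_closure_of_mem_spectral`: averaging over roots of unity is a contraction that
isolates a homogeneous component of a finite sum, a finite form of the Fourier coefficient integral.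

Finally `(A^{1/d})₍ₙ₎` and `A₍ₙ_d₎` have the same elements. The two actions satisfy `σ'_{z^d} = σ_z`
on `A^{1/d}`, every point of the circle is a `d`-th power, and `A₍ₙ_d₎` lies in `A^{1/d}` by the
averaging argument applied to the given grading. -/

namespace Pimsner

open scoped TensorProduct
open UniformSpace

/-! ### Isolating homogeneous components by averaging over roots of unity -/

namespace CircleAction

variable {A : Type u} [CStarAlgebra A] (σ : CircleAction A)

/-- The average of `ζᵏ σ_ζ` over the `N`-th roots of unity `ζ`. -/
noncomputable def rootAverage (N : ℕ) (k : ℤ) : A →ₗ[ℂ] A where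
  toFun x := ∑ j ∈ Finset.range N, (N : ℂ)⁻¹ •
    ((Circle.exp (2 * Real.pi / N) ^ j : Circle) : ℂ) ^ k •
      σ.toHom (Circle.exp (2 * Real.pi / N) ^ j) x
  map_add' x y := by simp only [map_add, smul_add, Finset.sum_add_distrib]
  map_smul' c x := by
    simp only [map_smul, RingHom.id_apply, Finset.smul_sum]
    refine Finset.sum_congr rfl fun j _ => ?_
    rw [smul_comm c, smul_comm c]

theorem rootAverage_apply (N : ℕ) (k : ℤ) (x : A) :
    σ.rootAverage N k x = ∑ j ∈ Finset.range N, (N : ℂ)⁻¹ •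
      ((Circle.exp (2 * Real.pi / N) ^ j : Circle) : ℂ) ^ k •
        σ.toHom (Circle.exp (2 * Real.pi / N) ^ j) x := rfl

theorem norm_rootAverage_le {N : ℕ} (hN : N ≠ 0) (k : ℤ) (x : A) :
    ‖σ.rootAverage N k x‖ ≤ ‖x‖ := by
  rw [rootAverage_apply]
  refine (norm_sum_le _ _).trans (le_of_eq ?_)
  have h : ∀ z : Circle, ‖σ.toHom z x‖ = ‖x‖ := fun z => StarAlgEquiv.norm_map (σ.toHom z) x
  simp only [norm_smul, norm_zpow, Circle.norm_coe, one_zpow, one_mul, h, Finset.sum_const,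
    Finset.card_range, nsmul_eq_mul, norm_inv, Complex.norm_natCast]
  rw [mul_inv_cancel_left₀ (Nat.cast_ne_zero.2 hN)]

theorem rootAverage_of_mem {n : ℤ} {x : A} (hx : x ∈ σ.spectral n) (N : ℕ) (k : ℤ) :
    σ.rootAverage N k x = ((N : ℂ)⁻¹ * ∑ j ∈ Finset.range N,
      (((Circle.exp (2 * Real.pi / N) : Circle) : ℂ) ^ (k - n)) ^ j) • x := by
  rw [rootAverage_apply, Finset.mul_sum, Finset.sum_smul]
  refine Finset.sum_congr rfl fun j _ => ?_
  have h : ∀ z : Circle, ((z ^ j : Circle) : ℂ) ^ k • σ.toHom (z ^ j) x =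
      ((z : ℂ) ^ (k - n)) ^ j • x := fun z => by
    have hz : (z : ℂ) ≠ 0 := Circle.coe_ne_zero z
    rw [hx, Circle.coe_pow, smul_smul, ← zpow_add₀ (pow_ne_zero j hz), ← sub_eq_add_neg,
      ← zpow_natCast, zpow_comm, zpow_natCast]
  rw [h, smul_smul]

theorem rootAverage_self {N : ℕ} (hN : N ≠ 0) {k : ℤ} {x : A} (hx : x ∈ σ.spectral k) :
    σ.rootAverage N k x = x := by
  rw [rootAverage_of_mem σ hx]
  simp [hN]

/-- Orthogonality of characters on the `N`-th roots of unity. The bound on `N` keeps `k - n` from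
being a nonzero multiple of `N`, a degree that `N`-th roots cannot tell from `0`. -/
theorem rootAverage_eq_zero {n k : ℤ} (h : n ≠ k) {x : A} (hx : x ∈ σ.spectral n) {N : ℕ}
    (hN : (k - n).natAbs < N) : σ.rootAverage N k x = 0 := by
  have hN0 : N ≠ 0 := by omega
  rw [rootAverage_of_mem σ hx]
  have hω : IsPrimitiveRoot ((Circle.exp (2 * Real.pi / N) : Circle) : ℂ) N := by
    convert Complex.isPrimitiveRoot_exp N hN0 using 1
    rw [Circle.coe_exp]
    congr 1
    push_cast
    ring
  set ω := ((Circle.exp (2 * Real.pi / N) : Circle) : ℂ)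
  have h1 : ω ^ (k - n) ≠ 1 := by
    rw [Ne, hω.zpow_eq_one_iff_dvd]
    intro hd
    have h2 := Nat.le_of_dvd (by omega) (Int.natCast_dvd.1 hd)
    omega
  have h2 : (ω ^ (k - n)) ^ N = 1 := by
    rw [← zpow_natCast, zpow_comm, zpow_natCast, hω.pow_eq_one, one_zpow]
  -- The geometric sum times `ω ^ (k - n) - 1`, a nonzero factor, equals `(ω ^ (k - n)) ^ N - 1 =
  -- 0`.
  have h3 := geom_sum_mul (ω ^ (k - n)) N
  rw [h2, sub_self] at h3
  rw [(mul_eq_zero.1 h3).resolve_right (sub_ne_zero.2 h1), mul_zero, zero_smul]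

/-- Homogeneous elements in the closure of a graded subspace are limits of homogeneous elements of
the same degree. -/
theorem mem_closure_of_mem_spectral {H : ℤ → Submodule ℂ A} (hH : ∀ n, H n ≤ σ.spectral n)
    {k : ℤ} {x : A} (hx : x ∈ σ.spectral k)
    (hxc : x ∈ closure ((⨆ n, H n : Submodule ℂ A) : Set A)) : x ∈ closure (H k : Set A) := by
  rw [Metric.mem_closure_iff] at hxc ⊢
  intro ε hε
  obtain ⟨y, hy, hxy⟩ := hxc ε hε
  -- No single `N` serves all degrees, but `y` has only finitely many components. Stating the claim
  -- for all large `N` makes it stable under sums.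
  have key : ∀ᶠ N : ℕ in Filter.atTop, σ.rootAverage N k y ∈ H k := by
    clear hxy
    induction hy using Submodule.iSup_induction' with
    | mem n y hy =>
      filter_upwards [Filter.eventually_gt_atTop (k - n).natAbs] with N hN
      by_cases h : n = k
      · subst h
        rwa [σ.rootAverage_self (by omega) (hH n hy)]
      · rw [σ.rootAverage_eq_zero h (hH n hy) hN]
        exact zero_mem _
    | zero => simp
    | add y z _ _ hy hz =>
      filter_upwards [hy, hz] with N h1 h2
      rw [map_add]
      exact add_mem h1 h2
  obtain ⟨N, hN, hN0⟩ := (key.and (Filter.eventually_ne_atTop 0)).exists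
  refine ⟨_, hN, lt_of_le_of_lt ?_ hxy⟩
  rw [dist_eq_norm, dist_eq_norm]
  -- As `x` equals its own average, the distance to the average of `y` is the norm of the average of
  -- `x - y`.
  conv_lhs => rw [← σ.rootAverage_self hN0 hx, ← map_sub]
  exact σ.norm_rootAverage_le hN0 k _

/-! ### Reduced words and semi-saturation -/

theorem spectral_mul_le {m n k : ℤ} (h : m + n = k) :
    σ.spectral m * σ.spectral n ≤ σ.spectral k :=
  Submodule.mul_le.2 fun _ hx _ hy => mul_mem_spectral h hx hy

theorem spectral_pow_mul_le (ε : ℤ) (n : ℕ) :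
    σ.spectral ε ^ n * σ.spectral 0 ≤ σ.spectral (n * ε) := by
  induction n with
  | zero => rw [pow_zero, one_mul, Nat.cast_zero, zero_mul]
  | succ n ih =>
    rw [pow_succ', mul_assoc]
    refine (mul_le_mul_right ih _).trans (σ.spectral_mul_le ?_)
    push_cast
    ring

/-- A left factor of degree `0` is absorbed by the first factor of degree `ε`, or by the trailing
`A₍₀₎` when `n = 0`. The latter is why words carry this trailing factor: a zeroth power of
submodules is only the scalars. -/
theorem spectral_zero_mul_pow_mul_le (ε : ℤ) (n : ℕ) :
    σ.spectral 0 * (σ.spectral ε ^ n * σ.spectral 0) ≤ σ.spectral ε ^ n * σ.spectral 0 := by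
  cases n with
  | zero =>
    rw [pow_zero, one_mul]
    exact σ.spectral_mul_le (zero_add 0)
  | succ n =>
    rw [pow_succ', mul_assoc, ← mul_assoc (σ.spectral 0)]
    exact mul_le_mul_left (σ.spectral_mul_le (zero_add ε)) _

/-- Cancellation of opposite degrees: the first two factors multiply into `A₍₀₎`, which the
remaining word absorbs. -/
theorem spectral_neg_mul_pow_mul_le {δ ε : ℤ} (h : δ + ε = 0) (n : ℕ) :
    σ.spectral δ * (σ.spectral ε ^ (n + 1) * σ.spectral 0) ≤
      σ.spectral ε ^ n * σ.spectral 0 := by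
  rw [pow_succ', mul_assoc, ← mul_assoc (σ.spectral δ)]
  exact (mul_le_mul_left (σ.spectral_mul_le h) _).trans
    (σ.spectral_zero_mul_pow_mul_le ε n)

/-- With at least one factor of degree `ε`, the last of them absorbs the trailing `A₍₀₎`. -/
theorem spectral_pow_succ_mul_le (ε : ℤ) (n : ℕ) :
    σ.spectral ε ^ (n + 1) * σ.spectral 0 ≤ σ.spectral ε ^ (n + 1) := by
  rw [pow_succ, mul_assoc]
  exact mul_le_mul_right (σ.spectral_mul_le (add_zero ε)) _

/-- The span of the reduced words of degree `n` in the spectral subspaces of degrees `-1, 0, 1`. -/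
noncomputable def words : ℤ → Submodule ℂ A
  | Int.ofNat n => σ.spectral 1 ^ n * σ.spectral 0
  | Int.negSucc n => σ.spectral (-1) ^ (n + 1) * σ.spectral 0

theorem words_natCast (n : ℕ) : σ.words n = σ.spectral 1 ^ n * σ.spectral 0 := rfl

theorem words_neg_natCast (n : ℕ) : σ.words (-n) = σ.spectral (-1) ^ n * σ.spectral 0 := by
  cases n with
  | zero =>
    rw [Nat.cast_zero, neg_zero, pow_zero]
    exact σ.words_natCast 0
  | succ n => rfl

theorem words_zero : σ.words 0 = σ.spectral 0 := by
  have h := σ.words_natCast 0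
  rwa [pow_zero, one_mul] at h

theorem words_le_spectral (n : ℤ) : σ.words n ≤ σ.spectral n := by
  obtain ⟨n, rfl | rfl⟩ := n.eq_nat_or_neg
  · rw [words_natCast]
    simpa using σ.spectral_pow_mul_le 1 n
  · rw [words_neg_natCast]
    simpa using σ.spectral_pow_mul_le (-1) n

theorem zero_mul_words_le (n : ℤ) : σ.spectral 0 * σ.words n ≤ σ.words n := by
  obtain ⟨n, rfl | rfl⟩ := n.eq_nat_or_neg
  · exact σ.spectral_zero_mul_pow_mul_le 1 n
  · rw [words_neg_natCast]
    exact σ.spectral_zero_mul_pow_mul_le (-1) n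

theorem one_mul_words_le (n : ℤ) : σ.spectral 1 * σ.words n ≤ σ.words (n + 1) := by
  obtain ⟨n, rfl | rfl⟩ := n.eq_nat_or_neg
  · rw [← Nat.cast_succ, words_natCast, words_natCast, pow_succ', mul_assoc]
  · cases n with
    | zero =>
      have h := σ.words_natCast 1
      rw [pow_one, Nat.cast_one] at h
      rw [Nat.cast_zero, neg_zero, zero_add, words_zero, h]
    | succ n =>
      rw [show -((n + 1 : ℕ) : ℤ) + 1 = -(n : ℤ) by push_cast; ring, words_neg_natCast,
        words_neg_natCast]
      exact σ.spectral_neg_mul_pow_mul_le (add_neg_cancel 1) n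

theorem neg_one_mul_words_le (n : ℤ) : σ.spectral (-1) * σ.words n ≤ σ.words (n - 1) := by
  obtain ⟨n, rfl | rfl⟩ := n.eq_nat_or_neg
  · cases n with
    | zero =>
      rw [Nat.cast_zero, zero_sub, words_zero, ← Nat.cast_one, words_neg_natCast, pow_one]
      simp
    | succ n =>
      rw [Nat.cast_succ, add_sub_cancel_right, ← Nat.cast_succ]
      exact σ.spectral_neg_mul_pow_mul_le (neg_add_cancel 1) n
  · rw [show -(n : ℤ) - 1 = -((n + 1 : ℕ) : ℤ) by push_cast; ring, words_neg_natCast,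
      words_neg_natCast, pow_succ', mul_assoc]

/-- The sum of the `words` contains `1` and is stable under left multiplication by the generators
and their adjoints, which have degrees `0`, `1` and `-1`. -/
theorem adjoin_le_iSup_words {x : A}
    (hx : x ∈ StarAlgebra.adjoin ℂ ((σ.spectral 0 : Set A) ∪ (σ.spectral 1 : Set A))) :
    x ∈ (⨆ n, σ.words n : Submodule ℂ A) := by
  have hmul : ∀ {m : ℤ} (f : ℤ → ℤ), (∀ n, σ.spectral m * σ.words n ≤ σ.words (f n)) →
      ∀ a ∈ σ.spectral m, ∀ y ∈ (⨆ n, σ.words n : Submodule ℂ A),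
        a * y ∈ (⨆ n, σ.words n : Submodule ℂ A) := by
    intro m f hf a ha y hy
    induction hy using Submodule.iSup_induction' with
    | mem n y hy => exact Submodule.mem_iSup_of_mem _ (hf n (Submodule.mul_mem_mul ha hy))
    | zero => rw [mul_zero]; exact zero_mem _
    | add y z _ _ hy hz => rw [mul_add]; exact add_mem hy hz
  have h0 := hmul _ σ.zero_mul_words_le
  -- Quantifying over `y` lets the induction pass through products without first proving the sum
  -- closed under multiplication; `y = 1` then gives the claim.
  have key : ∀ y ∈ (⨆ n, σ.words n : Submodule ℂ A),
      x * y ∈ (⨆ n, σ.words n : Submodule ℂ A) := by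
    change x ∈ Algebra.adjoin ℂ _ at hx
    induction hx using Algebra.adjoin_induction with
    | mem x hx =>
      rcases hx with (hx | hx) | (hx | hx)
      · exact h0 x hx
      · exact hmul _ σ.one_mul_words_le x hx
      · refine h0 x ?_
        rw [← star_star x]
        exact star_mem_spectral neg_zero hx
      · refine hmul _ σ.neg_one_mul_words_le x ?_
        rw [← star_star x]
        exact star_mem_spectral rfl hx
    | algebraMap c => exact h0 _ (σ.fixed.algebraMap_mem c)
    | add a b _ _ ha hb => intro y hy; rw [add_mul]; exact add_mem (ha y hy) (hb y hy)
    | mul a b _ _ ha hb => intro y hy; rw [mul_assoc]; exact ha _ (hb y hy)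
  have h1 := key 1 (Submodule.mem_iSup_of_mem 0 (by rw [words_zero]; exact one_mem σ.fixed))
  rwa [mul_one] at h1

variable {σ} in
theorem IsSemiSaturated.spectral_le_closure_words (h : σ.IsSemiSaturated) (n : ℤ) :
    (σ.spectral n : Set A) ⊆ closure (σ.words n : Set A) := by
  intro x hx
  refine σ.mem_closure_of_mem_spectral σ.words_le_spectral hx ?_
  refine closure_mono (fun y hy => σ.adjoin_le_iSup_words hy) ?_
  have hx' : x ∈ (StarAlgebra.adjoin ℂ
    ((σ.spectral 0 : Set A) ∪ (σ.spectral 1 : Set A))).topologicalClosure := by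
    rw [h]
    exact StarSubalgebra.mem_top
  exact hx'

variable {σ} in
-- This density makes the product map surjective. The exponent is positive so that the trailing
-- `A₍₀₎` of a word can be dropped.
theorem IsSemiSaturated.spectral_le_closure_pow (h : σ.IsSemiSaturated) {ε : ℤ}
    (hε : ε = 1 ∨ ε = -1) (n : ℕ) :
    (σ.spectral (ε * (n + 1 : ℕ)) : Set A) ⊆
      closure ((σ.spectral ε ^ (n + 1) : Submodule ℂ A) : Set A) := by
  refine (h.spectral_le_closure_words _).trans (closure_mono ?_)
  refine fun x hx => σ.spectral_pow_succ_mul_le ε n ?_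
  rcases hε with rfl | rfl
  · rwa [one_mul, words_natCast] at hx
  · rwa [neg_one_mul, words_neg_natCast] at hx

/-! ### Representations of Hilbert modules inside `A` -/

/-- A linear map into `A` that represents the inner product of a Hilbert module as `x⋆ y`. -/
def IsRepresentation (σ : CircleAction A) (E : HilbertModule σ.fixed) (L : E →ₗ[ℂ] A) : Prop :=
  ∀ x y, star (L x) * L y = (E.inner x y : A)

namespace IsRepresentation

variable {σ} {E : HilbertModule σ.fixed} {L : E →ₗ[ℂ] A}

theorem norm_map (h : IsRepresentation σ E L) (x : E) : ‖L x‖ = ‖x‖ := by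
  rw [← sq_eq_sq₀ (norm_nonneg _) (norm_nonneg _), E.norm_sq, sq,
    ← CStarRing.norm_star_mul_self, h]
  rfl

theorem isometry (h : IsRepresentation σ E L) : Isometry L :=
  AddMonoidHomClass.isometry_of_norm L h.norm_map

theorem isClosed_range (h : IsRepresentation σ E L) : IsClosed (LinearMap.range L : Set A) := by
  rw [LinearMap.coe_range]
  exact h.isometry.isClosedEmbedding.isClosed_range

/-- Compatibility with the right action is automatic: for `v = L (x b) - L x b`, the four terms of
`v⋆ v` are all `b⋆ ⟪x, x⟫ b` up to sign and cancel, so `v = 0` by the `C⋆`-identity. -/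
theorem map_right (h : IsRepresentation σ E L) (x : E) (b : σ.fixed) :
    L (E.right (MulOpposite.op b) x) = L x * (b : A) := by
  have hin : E.inner (E.right (MulOpposite.op b) x) x = star b * E.inner x x := by
    rw [← E.star_inner, E.inner_right, star_mul, E.star_inner]
  rw [← sub_eq_zero, ← CStarRing.star_mul_self_eq_zero_iff]
  have h1 := h (E.right (MulOpposite.op b) x) (E.right (MulOpposite.op b) x)
  have h2 := h (E.right (MulOpposite.op b) x) x
  have h3 := h x (E.right (MulOpposite.op b) x)
  have h4 := h x x
  rw [E.inner_right, hin] at h1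
  rw [hin] at h2
  rw [E.inner_right] at h3
  simp only [MulMemClass.coe_mul, StarMemClass.coe_star] at h1 h2 h3
  rw [star_sub, sub_mul, mul_sub, mul_sub, star_mul, h1, ← mul_assoc, h2, mul_assoc (star (b : A)),
    mul_assoc (star (b : A)), h3,
    mul_assoc _ (star (L x)), ← mul_assoc (star (L x)), h4]
  simp only [sub_self]

end IsRepresentation

/-! ### The product map on interior tensor powers -/

/-- The identity for `f` gives `‖f x‖² = ‖⟪x, x⟫‖`, so `f` is isometric for the seminorm and
extends; the identity persists by continuity. -/
theorem exists_extension {V : Type u} [AddCommGroup V] [Module ℂ V]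
    (P : PreCorrespondence σ.fixed V) (f : V →ₗ[ℂ] A)
    (hf : ∀ x y, star (f x) * f y = (P.inner x y : A)) :
    ∃ L : P.complete →ₗ[ℂ] A, IsRepresentation σ P.complete.toHilbertModule L ∧
      (∀ x, L (P.toComplete x) = f x) ∧
      ∀ x, L x ∈ closure (LinearMap.range f : Set A) := by
  let g : P.Space →L[ℂ] A := LinearMap.mkContinuous (f : P.Space →ₗ[ℂ] A) 1 fun x => by
    rw [one_mul, PreCorrespondence.norm_space]
    refine Real.le_sqrt_of_sq_le (le_of_eq ?_)
    rw [sq, ← CStarRing.norm_star_mul_self]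
    exact congrArg norm (hf x x)
  have hg : ∀ x : P.Space, g.fromCompletion (x : Completion P.Space) = f x := fun x => by
    rw [ContinuousLinearMap.fromCompletion_apply_coe]
    rfl
  refine ⟨(g.fromCompletion : Completion P.Space →ₗ[ℂ] A), ?_, hg, ?_⟩
  · intro x y
    change star (g.fromCompletion x) * g.fromCompletion y = (P.completionInner x y : A)
    change Completion P.Space at x y
    induction x, y using Completion.induction_on₂ with
    | hp => exact isClosed_eq (by fun_prop) (by fun_prop)
    | ih x y => rw [hg, hg, P.completionInner_coe]; exact hf x y
  · intro x
    change g.fromCompletion x ∈ _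
    change Completion P.Space at x
    induction x using Completion.induction_on with
    | hp => exact isClosed_closure.preimage g.fromCompletion.continuous
    | ih x => rw [hg]; exact subset_closure ⟨x, rfl⟩

/-- The multiplication map represents the interior tensor powers of a spectral subspace. -/
theorem exists_product_map (ε : ℤ) (n : ℕ) :
    ∃ L : ((σ.spectralModule ε).tensorPower (n + 1)).toHilbertModule →ₗ[ℂ] A,
      IsRepresentation σ _ L ∧
      (∀ x : Fin (n + 1) → σ.spectralModule ε,
        L ((σ.spectralModule ε).simpleTensor (n + 1) x) =
          (List.ofFn fun i => σ.inclusion ε (x i)).prod) ∧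
      (∀ x, L x ∈ σ.spectral (ε * (n + 1 : ℕ))) ∧
      σ.spectral ε ^ (n + 1) ≤ LinearMap.range L := by
  induction n with
  | zero =>
    refine ⟨σ.inclusion ε, fun x y => rfl, fun x => ?_, fun x => ?_, ?_⟩
    · simp only [List.ofFn_succ, List.ofFn_zero, List.prod_cons, List.prod_nil, mul_one]
      rfl
    · have hε : ε * ((0 + 1 : ℕ) : ℤ) = ε := by simp
      have hx : (x : σ.spectral ε).1 ∈ σ.spectral (ε * ((0 + 1 : ℕ) : ℤ)) := by
        rw [hε]
        exact x.2
      exact hx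
    · exact (pow_one (σ.spectral ε)).le.trans (Submodule.range_subtype _).ge
  | succ n ih =>
    obtain ⟨L, hL, hprod, hmem, hrange⟩ := ih
    let E := (σ.spectralModule ε).tensorPower (n + 1)
    let f : E ⊗[ℂ] σ.spectralModule ε →ₗ[ℂ] A :=
      TensorProduct.lift ((LinearMap.mul ℂ A).compl₁₂ L (σ.inclusion ε))
    have hf_tmul : ∀ x y, f (x ⊗ₜ y) = L x * σ.inclusion ε y := fun _ _ => rfl
    have hf : ∀ x y, star (f x) * f y =
        (Correspondence.tensorInner E (σ.spectralModule ε) x y : A) := by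
      intro x y
      induction x with
      | zero => simp
      | add x x' hx hx' =>
        simp only [map_add, star_add, add_mul, hx, hx', LinearMap.add_apply, AddMemClass.coe_add]
      | tmul x₁ x₂ =>
        induction y with
        | zero => simp
        | add y y' hy hy' => simp only [map_add, mul_add, hy, hy', AddMemClass.coe_add]
        | tmul y₁ y₂ =>
          -- The inner pair `(L x₁)⋆ (L y₁)` is `⟪x₁, y₁⟫` by induction, and acts on `y₂` by left
          -- multiplication.
          rw [hf_tmul, hf_tmul, Correspondence.tensorInner_tmul, star_mul, mul_assoc,
            ← mul_assoc (star (L x₁)), hL]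
          rfl
    obtain ⟨M, hM, hMf, hMc⟩ := σ.exists_extension
      (Correspondence.algTensor E (σ.spectralModule ε)) f hf
    refine ⟨M, hM, fun x => ?_, fun x => ?_, ?_⟩
    · refine (hMf _).trans ?_
      rw [hf_tmul]
      erw [hprod]
      conv_rhs => rw [List.ofFn_succ', List.concat_eq_append, List.prod_append, List.prod_singleton]
      rfl
    -- Elements of the completion need not be finite sums of tensors, but spectral subspaces are
    -- closed, so simple tensors decide the degree.
    · refine closure_minimal ?_ (isClosed_spectral _) (hMc x)
      rintro _ ⟨z, rfl⟩
      induction z with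
      | zero => rw [map_zero]; exact zero_mem _
      | add y z hy hz => rw [map_add]; exact add_mem hy hz
      | tmul y z =>
        rw [hf_tmul]
        exact mul_mem_spectral (by push_cast; ring) (hmem y) z.2
    · rw [pow_succ]
      refine Submodule.mul_le.2 fun a ha b hb => ?_
      obtain ⟨x, rfl⟩ := hrange ha
      exact ⟨_, hMf (x ⊗ₜ (⟨b, hb⟩ : σ.spectral ε))⟩

end CircleAction

/-! ### Comparing `A` with `A^{1/d}`, and the isomorphisms -/

namespace CircleGrading

variable {A : Type u} [CStarAlgebra A] (G : CircleGrading A)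

theorem gr_le_spectral (n : ℤ) : G.gr n ≤ G.action.spectral n := fun _ hx w =>
  G.action_apply w hx

theorem spectral_le_closure_gr (n : ℤ) :
    (G.action.spectral n : Set A) ⊆ closure (G.gr n : Set A) := fun x hx =>
  G.action.mem_closure_of_mem_spectral G.gr_le_spectral hx (G.dense x)

theorem spectral_le_rootAlgebra (d : ℕ) (n : ℤ) {x : A} (hx : x ∈ G.action.spectral (n * d)) :
    x ∈ G.rootAlgebra d :=
  closure_minimal (fun _ hy => G.gr_le_rootAlgebra d n hy)
    (StarSubalgebra.isClosed_topologicalClosure _) (G.spectral_le_closure_gr _ hx)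

variable (d : ℕ) [NeZero d]

/-- On `𝒜₍ₙ_d₎` both sides multiply by `z ^ (-(n * d))`, and these subspaces span a dense subspace
of `A^{1/d}`. -/
theorem root_action_pow (z : Circle) (x : G.rootAlgebra d) :
    (((G.root d).action.toHom (z ^ d) x : G.rootAlgebra d) : A) = G.action.toHom z x := by
  refine DFunLike.congr_fun (add_ext (G := G.root d)
    (f := ((G.rootAlgebra d).subtype : G.rootAlgebra d →+ A).comp
      ((G.root d).action.toHom (z ^ d) : G.rootAlgebra d →+ G.rootAlgebra d))
    (g := (G.action.toHom z : A →+ A).comp ((G.rootAlgebra d).subtype : G.rootAlgebra d →+ A))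
    ?_ ?_ ?_) x
  · exact continuous_subtype_val.comp (StarAlgEquiv.isometry ((G.root d).action.toHom _)).continuous
  · exact (StarAlgEquiv.isometry (G.action.toHom z)).continuous.comp continuous_subtype_val
  · intro n x hx
    change (((G.root d).action.toHom (z ^ d) x : G.rootAlgebra d) : A) = G.action.toHom z x
    have hx' : (x : A) ∈ G.gr (n * d) := hx
    rw [(G.root d).action_apply _ hx, G.action_apply z hx']
    change ((z ^ d : Circle) : ℂ) ^ (-n) • (x : A) = _
    rw [Circle.coe_pow, ← zpow_natCast, ← zpow_mul]
    congr 2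
    ring

theorem mem_root_spectral {n : ℤ} {x : G.rootAlgebra d} :
    x ∈ (G.root d).action.spectral n ↔ (x : A) ∈ G.action.spectral (n * d) := by
  have hpow : ∀ z : Circle, ((z ^ d : Circle) : ℂ) ^ (-n) = (z : ℂ) ^ (-(n * d)) := fun z => by
    rw [Circle.coe_pow, ← zpow_natCast, ← zpow_mul]
    congr 1
    ring
  refine ⟨fun h z => ?_, fun h w => ?_⟩
  · rw [← G.root_action_pow d, h, ← hpow]
    rfl
  -- Taking a `d`-th root of `w` turns the action on `A^{1/d}` into the action on `A`.
  · obtain ⟨z, rfl⟩ : ∃ z : Circle, z ^ d = w := by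
      obtain ⟨t, rfl⟩ := Circle.exp_surjective w
      refine ⟨Circle.exp (t / d), ?_⟩
      rw [← Circle.exp_nsmul, nsmul_eq_mul, mul_div_cancel₀ _ (Nat.cast_ne_zero.2 (NeZero.ne d))]
    refine Subtype.ext ?_
    rw [G.root_action_pow d, h, ← hpow]
    rfl

/-- The spectral subspaces of `A^{1/d}` are those of `A` of degree divisible by `d`. -/
noncomputable def rootSpectralEquiv (n : ℤ) :
    G.action.spectral (n * d) ≃ₗ[ℂ] (G.root d).action.spectral n where
  toFun x := ⟨⟨x, G.spectral_le_rootAlgebra d n x.2⟩, (G.mem_root_spectral d).2 x.2⟩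
  map_add' _ _ := rfl
  map_smul' _ _ := rfl
  invFun x := ⟨x, (G.mem_root_spectral d).1 x.2⟩
  left_inv _ := rfl
  right_inv _ := rfl

/-- The fixed point algebras of `A` and `A^{1/d}` agree. -/
noncomputable def fixedEquiv : G.action.fixed ≃⋆ₐ[ℂ] (G.root d).action.fixed where
  toFun x :=
    have hx : (x : A) ∈ G.action.spectral (0 * d) := by
      rw [zero_mul]
      exact x.2
    ⟨⟨x, G.spectral_le_rootAlgebra d 0 hx⟩, (G.mem_root_spectral d).2 hx⟩
  invFun x := ⟨x, by
    have h := (G.mem_root_spectral d).1 x.2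
    rwa [zero_mul] at h⟩
  map_mul' _ _ := rfl
  map_add' _ _ := rfl
  map_star' _ := rfl
  map_smul' _ _ := rfl
  left_inv _ := rfl
  right_inv _ := rfl

theorem exists_tensorPower_equiv (hG : G.action.IsSemiSaturated) {ε : ℤ} (hε : ε = 1 ∨ ε = -1) :
    ∃ ψ : UnitaryEquiv (G.fixedEquiv d)
        ((G.action.spectralModule ε).tensorPower d).toHilbertModule
        ((G.root d).action.spectralModule ε).toHilbertModule,
      ∀ x : Fin d → G.action.spectralModule ε,
        ((G.root d).action.inclusion ε
          (ψ.toLinearEquiv ((G.action.spectralModule ε).simpleTensor d x)) : A) =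
            (List.ofFn fun i => G.action.inclusion ε (x i)).prod := by
  obtain ⟨n, rfl⟩ := Nat.exists_eq_succ_of_ne_zero (NeZero.ne d)
  obtain ⟨L, hL, hprod, hmem, hrange⟩ := G.action.exists_product_map ε n
  have hsurj : Function.Surjective (L.codRestrict _ hmem) := fun y => by
    -- The range is closed and contains the dense power `A₍ε₎ⁿ⁺¹`, hence all of `A₍ε(n+1)₎`.
    obtain ⟨x, hx⟩ := closure_minimal hrange hL.isClosed_range
      (hG.spectral_le_closure_pow hε n y.2)
    exact ⟨x, Subtype.ext hx⟩
  have hinj : Function.Injective (L.codRestrict _ hmem) := fun x y hxy =>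
    hL.isometry.injective (congrArg Subtype.val hxy)
  let e := (LinearEquiv.ofBijective (L.codRestrict _ hmem) ⟨hinj, hsurj⟩).trans
    (G.rootSpectralEquiv (n + 1) ε)
  -- All identifications with `A^{1/d}` keep the underlying element of `A`, so each identity is
  -- checked in `A`.
  exact ⟨⟨e, fun x y => Subtype.ext (Subtype.ext (hL x y)),
    fun x b => Subtype.ext (Subtype.ext (hL.map_right x b))⟩, hprod⟩

end CircleGrading

end Pimsner

theorem propositionp {A : Type u} [CStarAlgebra A] (G : Pimsner.CircleGrading A)
    (hG : G.action.IsSemiSaturated) (d : ℕ) [NeZero d] :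
    ∃ κ : G.action.fixed ≃⋆ₐ[ℂ] (G.root d).action.fixed,
      (∀ a : G.action.fixed, ((κ a : G.rootAlgebra d) : A) = a) ∧
      (∃ ψ : Pimsner.UnitaryEquiv κ
          ((G.action.spectralModule 1).tensorPower d).toHilbertModule
          ((G.root d).action.spectralModule 1).toHilbertModule,
        ∀ x : Fin d → G.action.spectralModule 1,
          ((G.root d).action.inclusion 1
            (ψ.toLinearEquiv ((G.action.spectralModule 1).simpleTensor d x)) : A) =
              (List.ofFn fun i => G.action.inclusion 1 (x i)).prod) ∧
      (∃ ψ : Pimsner.UnitaryEquiv κ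
          ((G.action.spectralModule (-1)).tensorPower d).toHilbertModule
          ((G.root d).action.spectralModule (-1)).toHilbertModule,
        ∀ x : Fin d → G.action.spectralModule (-1),
          ((G.root d).action.inclusion (-1)
            (ψ.toLinearEquiv ((G.action.spectralModule (-1)).simpleTensor d x)) : A) =
              (List.ofFn fun i => G.action.inclusion (-1) (x i)).prod) :=
  ⟨G.fixedEquiv d, fun _ => rfl, G.exists_tensorPower_equiv d hG (Or.inl rfl),
    G.exists_tensorPower_equiv d hG (Or.inr rfl)⟩
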